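/- Let $Q$ be a finite set of states, $\Sigma$ a finite non-empty alphabet, and let $\mathcal W=(Q,\Sigma,\delta,q_\iota,\mathrm{Acc})$ be a probabilistic parity word automaton: $\delta:Q\times\Sigma\times Q\to[0,1]$ satisfies $\sum_{p\in Q}\delta(q,a,p)=1$ for all $q\in Q$, $a\in\Sigma$, and for some $k\in\mathbb N$ and $\alpha:Q\to\{0,\dots,k\}$, the set $\mathrm{Acc}\subseteq Q^\omega$ consists of the sequences for which the least value of $\alpha$ on the states visited infinitely often is even. Assume that $\mathcal W$ is binary branching, i.e. $\delta(q,a,p)\in\{0,\tfrac12\}$ for all $q,a,p$; thus for all $q,a$ there are exactly two states $q_1\neq q_2$ with $\delta(q,a,q_i)=\frac12$, and we write $\delta(q,a)=\{q_1,q_2\}$. A probabilistic tree automaton $\mathcal A=(Q,\Sigma,\delta',q_\iota,\mathrm{Acc})$ has a transition function $\delta':Q\times\Sigma\times Q\times Q\to[0,1]$ with $\sum_{q_0,q_1}\delta'(q,a,q_0,q_1)=1$ for all $q,a$. A run of $\mathcal A$ on a tree $t:\{0,1\}^*\to\Sigma$ is a map $r:\{0,1\}^*\to Q$ with $r(\varepsilon)=q_\iota$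 and $\delta'(r(x),t(x),r(x0),r(x1))>0$ for all $x\in\{0,1\}^*$. It is qualitatively accepting if the set of $b\in\{0,1\}^\omega$ with $r(\varepsilon)\,r(b_0)\,r(b_0b_1)\cdots\in\mathrm{Acc}$ has measure $1$ for the coin-flipping measure (which gives the cone $x\{0,1\}^\omega$ the measure $2^{-|x|}$). Let $\mu_t$ be the probability measure on maps $\{0,1\}^*\to Q$ for which, for every $n$ and every $r$ with $r(\varepsilon)=q_\iota$, the set of maps that agree with $r$ on all words of length at most $n$ has measure $\prod_{|x|<n}\delta'(r(x),t(x),r(x0),r(x1))$. The qualitative almost-sure language of $\mathcal A$ is $$L^{=1}_{\mathrm{Qual}}(\mathcal A)=\{t : \mu_t(\{r : r \text{ is a qualitatively accepting run of } \mathcal A \text{ on } t\})=1\}.$$ Let $\mathcal A_{\mathcal W}=(Q,\Sigma,\delta_1,q_\iota,\mathrm{Acc})$ with $\delta_1(q,a,p,p)=\delta(q,a,p)$ and $\delta_1(q,a,p,p')=0$ for $p\neq p'$. Let $\mathcal A_{\mathrm{switch}}=(Q,\Sigma,\delta_2,q_\iota,\mathrm{Acc})$ with $\delta_2(q,a,q_1,q_2)=\delta_2(q,a,q_2,q_1)=\frac12$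 whenever $\delta(q,a)=\{q_1,q_2\}$, $q_1\ne q_2$, and $\delta_2(q,a,p,p')=0$ in all other cases. Then $$L^{=1}_{\mathrm{Qual}}(\mathcal A_{\mathcal W})=L^{=1}_{\mathrm{Qual}}(\mathcal A_{\mathrm{switch}}).$$ -/

import Mathlib

open MeasureTheory
open scoped ENNReal

namespace ProbAut

/-! ### Trees and branches -/

/-- Nodes of the infinite binary tree: words over `{0,1}` (`false` is `0`, `true` is `1`);
the empty word is the root, and the children of `x` are `x ++ [false]` and `x ++ [true]`. -/
abbrev Node : Type := List Bool

/-- An `L`-tree. -/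
abbrev Tree (L : Type*) : Type _ := Node → L

/-- A branch, as an infinite word over `{0,1}`. -/
abbrev Branch : Type := ℕ → Bool

/-- The node `b₀ b₁ … b₍ₙ₋₁₎` of length `n` on the branch `b`. -/
def branchNode (b : Branch) (n : ℕ) : Node := (List.range n).map b

/-- The sequence of labels `t(ε) t(b₀) t(b₀b₁) …` along the branch `b`. -/
def labelsAlong {L : Type*} (t : Tree L) (b : Branch) : ℕ → L := fun n => t (branchNode b n)

/-- The coin-flipping probability measure on branches: independent fair coins. -/
noncomputable def coinMeasure : Measure Branch :=
  Measure.infinitePi fun _ : ℕ => (PMF.uniformOfFintype Bool).toMeasure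

/-- The cone of a node: all branches that pass through it. -/
def branchCone (x : Node) : Set Branch := {b | branchNode b x.length = x}

/-! ### The parity condition -/

/-- The elements that occur infinitely often in a sequence. -/
def infSet {Q : Type*} (r : ℕ → Q) : Set Q := {q | ∃ᶠ n in Filter.atTop, r n = q}

/-- The parity condition of a priority function: the least priority seen infinitely often
is even. -/
def parityCondition {Q : Type*} (α : Q → ℕ) : Set (ℕ → Q) :=
  {r | Even (sInf (α '' infSet r))}

/-- `acc` is a parity condition, for some priority function with values in `{0, …, k}`. -/
def IsParityCondition {Q : Type*} (acc : Set (ℕ → Q)) : Prop :=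
  ∃ (k : ℕ) (α : Q → ℕ), (∀ q, α q ≤ k) ∧ acc = parityCondition α

/-! ### Probabilistic word automata -/

/-- A probabilistic word automaton with states `Q` and alphabet `A`: `δ q a p` is the
probability of moving from `q` to `p` when reading `a`. -/
structure WordAutomaton (Q A : Type*) where
  δ : Q → A → PMF Q
  init : Q
  acc : Set (ℕ → Q)

/-- Binary branching: all transition probabilities are `0` or `1/2`. -/
def WordAutomaton.BinaryBranching {Q A : Type*} (W : WordAutomaton Q A) : Prop :=
  ∀ q a p, W.δ q a p = 0 ∨ W.δ q a p = 1 / 2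

/-- The set of successors of `q` on `a` that are reached with probability `1/2`. -/
def WordAutomaton.succs {Q A : Type*} (W : WordAutomaton Q A) (q : Q) (a : A) : Set Q :=
  {p | W.δ q a p = 1 / 2}

/-! ### Probabilistic tree automata -/

/-- A probabilistic tree automaton with states `Q` and alphabet `A`: `δ q a (q₀, q₁)` is the
probability that a node with letter `a` and state `q` sends `q₀` to its child `0` and
`q₁` to its child `1`. -/
structure TreeAutomaton (Q A : Type*) where
  δ : Q → A → PMF (Q × Q)
  init : Q
  acc : Set (ℕ → Q)

namespace TreeAutomaton

variable {Q A : Type*}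

/-- Runs on the tree `t`: the root carries the initial state, and all transitions used have
positive probability. -/
def IsRun (T : TreeAutomaton Q A) (t : Tree A) (r : Tree Q) : Prop :=
  r [] = T.init ∧ ∀ x : Node, 0 < T.δ (r x) (t x) (r (x ++ [false]), r (x ++ [true]))

/-- The labelling of the tree is qualitatively accepting: almost all of its branches are
accepting. -/
def IsQualAccepting (T : TreeAutomaton Q A) (r : Tree Q) : Prop :=
  coinMeasure {b | labelsAlong r b ∈ T.acc} = 1

/-- The set of qualitatively accepting runs on `t`. -/
def qualAccRuns (T : TreeAutomaton Q A) (t : Tree A) : Set (Tree Q) :=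
  {r | T.IsRun t r ∧ T.IsQualAccepting r}

/-- The labelling that starts in the initial state and in which a node `x` with label `q` sends
the two components of `c (x, q)` to its two children. -/
def runOfChoices (T : TreeAutomaton Q A) (c : Node × Q → Q × Q) (x : Node) : Q :=
  List.reverseRecOn x T.init
    (fun y i q => if i then (c (y, q)).2 else (c (y, q)).1)

/-- The probability measure on the labellings of the tree by states that a tree automaton
induces on an input tree `t`: independently for all nodes `x` and states `q`, a pair of states
is drawn from the distribution `δ q (t x)`, and these choices are followed from the initial state
at the root. By `runMeasure_runCone` below, the cone of a partial labelling of the first levels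
has as its measure the product of the probabilities of the transitions in it. -/
noncomputable def runMeasure [MeasurableSpace Q] (T : TreeAutomaton Q A) (t : Tree A) :
    Measure (Tree Q) :=
  (Measure.infinitePi fun i : Node × Q => (T.δ i.2 (t i.1)).toMeasure).map T.runOfChoices

/-- The qualitative almost-sure language: the trees on which almost every run is qualitatively
accepting. -/
def qualASLanguage [MeasurableSpace Q] (T : TreeAutomaton Q A) : Set (Tree A) :=
  {t | T.runMeasure t (T.qualAccRuns t) = 1}

end TreeAutomaton

/-! ### The measures on cones -/

/-- The nodes on the levels below `n`. -/
noncomputable def nodesBelow (n : ℕ) : Finset Node := (List.finite_length_lt Bool n).toFinset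

lemma length_branchNode (b : Branch) (n : ℕ) : (branchNode b n).length = n := by
  simp [branchNode]

/-- The cone of the node `x` has measure `2 ^ (-|x|)`. -/
theorem coinMeasure_branchCone (x : Node) :
    coinMeasure (branchCone x) = (2 ^ x.length)⁻¹ := by
  have h : branchCone x = Set.pi (Finset.range x.length : Set ℕ) (fun n => {x.getD n false}) := by
    ext b
    simp only [branchCone, Set.mem_ofPred_eq, Set.mem_pi, Finset.coe_range, Set.mem_Iio,
      Set.mem_singleton_iff]
    constructor
    · intro h n hn
      conv_rhs => rw [← h]
      simp [branchNode, hn]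
    · intro h
      apply List.ext_getElem (length_branchNode b _)
      intro i h1 h2
      have := h i h2
      simp [branchNode, this, h2]
  rw [h, coinMeasure, Measure.infinitePi_pi _ (fun _ _ => MeasurableSet.singleton _)]
  simp [ENNReal.inv_pow]

namespace TreeAutomaton

variable {Q A : Type*}

/-- The cone of the first levels, up to level `n`, of the labelling `r`. -/
def runCone (r : Tree Q) (n : ℕ) : Set (Tree Q) := {r' | ∀ x : Node, x.length ≤ n → r' x = r x}

lemma runOfChoices_nil (T : TreeAutomaton Q A) (c : Node × Q → Q × Q) :
    T.runOfChoices c [] = T.init := by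
  simp [runOfChoices]

lemma runOfChoices_append (T : TreeAutomaton Q A) (c : Node × Q → Q × Q) (x : Node) (i : Bool) :
    T.runOfChoices c (x ++ [i]) =
      if i then (c (x, T.runOfChoices c x)).2 else (c (x, T.runOfChoices c x)).1 := by
  simp [runOfChoices]

lemma measurable_runOfChoices [Finite Q] [MeasurableSpace Q] [DiscreteMeasurableSpace Q]
    (T : TreeAutomaton Q A) : Measurable T.runOfChoices := by
  refine measurable_pi_iff.2 fun x => ?_
  induction x using List.reverseRecOn with
  | nil => simp only [runOfChoices_nil]; exact measurable_const
  | append_singleton x i ih =>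
    simp only [runOfChoices_append]
    have h : Measurable fun c : Node × Q → Q × Q => c (x, T.runOfChoices c x) := by
      have h2 : Measurable fun p : (Q → Q × Q) × Q => p.1 p.2 :=
        measurable_from_prod_countable_left fun q => measurable_pi_apply q
      exact h2.comp ((measurable_pi_lambda _ fun q => measurable_pi_apply (x, q)).prodMk ih)
    cases i
    · simpa [Function.comp_def] using measurable_fst.comp h
    · simpa [Function.comp_def] using measurable_snd.comp h

instance isProbabilityMeasure_runMeasure [Finite Q] [MeasurableSpace Q]
    [DiscreteMeasurableSpace Q] (T : TreeAutomaton Q A) (t : Tree A) :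
    IsProbabilityMeasure (T.runMeasure t) :=
  Measure.isProbabilityMeasure_map T.measurable_runOfChoices.aemeasurable

/-- The measure of the cone of a partial labelling that starts in the initial state is the product
of the probabilities of all transitions in it. -/
theorem runMeasure_runCone [Finite Q] [MeasurableSpace Q] [DiscreteMeasurableSpace Q]
    (T : TreeAutomaton Q A) (t : Tree A) (r : Tree Q) (hr : r [] = T.init) (n : ℕ) :
    T.runMeasure t (runCone r n) =
      ∏ x ∈ nodesBelow n, T.δ (r x) (t x) (r (x ++ [false]), r (x ++ [true])) := by
  classical
  have hm : MeasurableSet (runCone r n) := by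
    have : runCone r n = ⋂ x : Node, ⋂ _ : x.length ≤ n, (fun r' : Tree Q => r' x) ⁻¹' {r x} := by
      ext; simp [runCone]
    rw [this]
    exact MeasurableSet.iInter fun x => MeasurableSet.iInter fun _ =>
      measurable_pi_apply x (MeasurableSet.singleton _)
  have hinj : Function.Injective fun x : Node => (x, r x) := fun x y h => (Prod.ext_iff.1 h).1
  have hpre : T.runOfChoices ⁻¹' runCone r n =
      Set.pi ((nodesBelow n).image fun x => (x, r x) : Finset (Node × Q))
        (fun i => {(r (i.1 ++ [false]), r (i.1 ++ [true]))}) := by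
    ext c
    simp only [runCone, nodesBelow, Set.mem_preimage, Set.mem_ofPred_eq, Set.mem_pi,
      Finset.coe_image, Set.Finite.coe_toFinset, Set.forall_mem_image, Set.mem_singleton_iff]
    constructor
    · intro h x hx
      have h0 := h x hx.le
      have h1 := h (x ++ [false]) (by simpa using hx)
      have h2 := h (x ++ [true]) (by simpa using hx)
      rw [runOfChoices_append, h0] at h1 h2
      exact Prod.ext (by simpa using h1) (by simpa using h2)
    · intro h x
      induction x using List.reverseRecOn with
      | nil => intro _; rw [runOfChoices_nil, hr]
      | append_singleton x i ih =>
        intro hx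
        have hx' : x.length < n := by simpa using hx
        rw [runOfChoices_append, ih hx'.le, h hx']
        cases i <;> simp
  rw [runMeasure, Measure.map_apply T.measurable_runOfChoices hm, hpre,
    Measure.infinitePi_pi _ (fun _ _ => MeasurableSet.singleton _),
    Finset.prod_image (fun x _ y _ h => hinj h)]
  exact Finset.prod_congr rfl fun x _ => PMF.toMeasure_apply_singleton _ _ (MeasurableSet.singleton _)

end TreeAutomaton

/-! ### The two tree automata of a word automaton -/

namespace WordAutomaton

variable {Q A : Type*}

open Classical in
/-- The tree automaton of `W` that sends the same successor to both children:
the transition `(q, a, p, p)` has probability `δ(q, a, p)`, and `(q, a, p, p')` has probability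
`0` if `p ≠ p'`. -/
noncomputable def toTreeAutomaton [Fintype Q] (W : WordAutomaton Q A) : TreeAutomaton Q A where
  δ q a := PMF.ofFintype (fun s => if s.1 = s.2 then W.δ q a s.1 else 0) (by
    rw [Fintype.sum_prod_type]
    simp only [Finset.sum_ite_eq, Finset.mem_univ, if_true]
    rw [← tsum_fintype (L := .unconditional Q)]
    exact (W.δ q a).tsum_coe)
  init := W.init
  acc := W.acc

/-- In a binary branching automaton, every state has exactly two successors on every letter. -/
theorem BinaryBranching.exists_succs [Finite Q] {W : WordAutomaton Q A}
    (hW : W.BinaryBranching) (q : Q) (a : A) : ∃ p p', p ≠ p' ∧ W.succs q a = {p, p'} := by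
  classical
  have := Fintype.ofFinite Q
  have h1 : ∑ p, W.δ q a p = 1 := by
    rw [← tsum_fintype (L := .unconditional Q)]
    exact (W.δ q a).tsum_coe
  have h2 : ∀ p, W.δ q a p = if W.δ q a p = 1 / 2 then 1 / 2 else 0 := by
    intro p
    rcases hW q a p with h | h <;> simp [h]
  rw [Finset.sum_congr rfl fun p _ => h2 p, ← Finset.sum_filter, Finset.sum_const] at h1
  set s : Finset Q := Finset.univ.filter fun p => W.δ q a p = 1 / 2 with hs
  have hc : s.card = 2 := by
    have h3 : (s.card : ℝ≥0∞) = 2 := by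
      rw [nsmul_eq_mul, one_div] at h1
      have h4 : (s.card : ℝ≥0∞) * 2⁻¹ * 2 = 1 * 2 := by rw [h1]
      rwa [mul_assoc, ENNReal.inv_mul_cancel (by simp) (by simp), mul_one, one_mul] at h4
    exact_mod_cast h3
  obtain ⟨p, p', hne, hpp⟩ := Finset.card_eq_two.1 hc
  refine ⟨p, p', hne, ?_⟩
  have h5 : W.succs q a = (s : Set Q) := by ext x; simp [succs, hs]
  rw [h5, hpp]
  simp

open Classical in
/-- The switch automaton of a binary branching `W`: if the two successors of `q` on `a` are
`q₁ ≠ q₂`, then `(q, a, q₁, q₂)` and `(q, a, q₂, q₁)` have probability `1/2`; all other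
transitions have probability `0`. -/
noncomputable def switchAutomaton [Fintype Q] (W : WordAutomaton Q A) (hW : W.BinaryBranching) :
    TreeAutomaton Q A where
  δ q a := PMF.ofFintype
    (fun s => if s.1 ≠ s.2 ∧ W.succs q a = {s.1, s.2} then 1 / 2 else 0) (by
      obtain ⟨p, p', hne, h⟩ := hW.exists_succs q a
      have h1 : ∀ s : Q × Q, (s.1 ≠ s.2 ∧ W.succs q a = {s.1, s.2}) ↔
          s ∈ ({(p, p'), (p', p)} : Finset (Q × Q)) := by
        rintro ⟨x, y⟩
        rw [h, Set.pair_eq_pair_iff]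
        simp only [Finset.mem_insert, Finset.mem_singleton, Prod.mk.injEq]
        grind
      have h2 : (p, p') ≠ (p', p) := fun h => hne (Prod.ext_iff.1 h).1
      simp only [h1]
      rw [Finset.sum_ite_mem, Finset.univ_inter, Finset.sum_pair h2]
      simp [ENNReal.inv_two_add_inv_two])
  init := W.init
  acc := W.acc

end WordAutomaton

end ProbAut

/-! By Fubini, almost every run has almost all branches accepting if and only if, for almost every
branch `b`, almost every run is accepting along `b` (`mem_qualASLanguage_iff`). For a fixed `b` only
the law of the labels along `b` matters. A branch meets each level once, so these labels form a
Markov chain whose step at level `n` is the marginal of the transition distribution in direction `b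
n` (`map_labelsAlong_runMeasure`). How the two children of a node are correlated plays no role. Both
tree automata have `W.δ q a` as marginal in either direction, so along every branch both produce the
random run of `W` on the letters of that branch, and the languages agree (`qualASLanguage_congr`).
-/

namespace ProbAut

/-! ### Measurability of acceptance -/

section Measurability

variable {Q : Type*} [Finite Q] [MeasurableSpace Q] [DiscreteMeasurableSpace Q]

/-- Acceptance depends only on `infSet r`, which takes finitely many values as `Q` is finite; each
"`q` occurs infinitely often" is a countable combination of coordinate events. -/
lemma measurableSet_parityCondition (α : Q → ℕ) : MeasurableSet (parityCondition α) := by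
  have hS : ∀ S : Set Q, MeasurableSet {r : ℕ → Q | infSet r = S} := by
    intro S
    have : {r : ℕ → Q | infSet r = S} =
        ⋂ q, {r : ℕ → Q | (∃ᶠ n in Filter.atTop, r n = q) ↔ q ∈ S} := by
      ext r
      simp only [infSet, Set.ext_iff, Set.mem_ofPred_eq, Set.mem_iInter]
    rw [this]
    refine MeasurableSet.iInter fun q => ?_
    have hq : MeasurableSet {r : ℕ → Q | ∃ᶠ n in Filter.atTop, r n = q} := by
      simp only [Filter.frequently_atTop]
      have h : ∀ n, Measurable fun r : ℕ → Q => r n = q := fun n =>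
        (measurableSet_setOfPred.1 (MeasurableSet.singleton q)).comp (measurable_pi_apply n)
      exact measurableSet_setOfPred.2 (Measurable.forall fun a => Measurable.exists fun b =>
        measurable_const.and (h b))
    exact measurableSet_setOfPred.2 ((measurableSet_setOfPred.1 hq).iff measurable_const)
  have : parityCondition α =
      ⋃ S ∈ {S : Set Q | Even (sInf (α '' S))}, {r : ℕ → Q | infSet r = S} := by
    ext r
    simp [parityCondition]
  rw [this]
  exact MeasurableSet.biUnion (Set.to_countable _) fun S _ => hS S

lemma IsParityCondition.measurableSet {acc : Set (ℕ → Q)} (h : IsParityCondition acc) :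
    MeasurableSet acc := by
  obtain ⟨_, α, _, rfl⟩ := h
  exact measurableSet_parityCondition α

omit [Finite Q] [DiscreteMeasurableSpace Q] in
-- Measurability jointly in tree and branch is what the exchange of quantifiers by Fubini requires.
lemma measurable_labelsAlong :
    Measurable fun p : Tree Q × Branch => labelsAlong p.1 p.2 := by
  -- Nodes are countable, so with the discrete σ-algebra the evaluation `(r, x) ↦ r x` is jointly
  -- measurable.
  let _ : MeasurableSpace Node := ⊤
  refine measurable_pi_iff.2 fun n => ?_
  have h1 : Measurable fun b : Branch => branchNode b n := by
    have h2 : Measurable fun b : Branch => fun i : Fin n => b i :=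
      measurable_pi_lambda _ fun i => measurable_pi_apply _
    have h3 : (fun b : Branch => branchNode b n) =
        (fun u : Fin n → Bool => List.ofFn u) ∘ fun b i => b i := by
      ext b : 1
      simp [branchNode, List.ofFn_eq_map, ← List.map_coe_finRange_eq_range, Function.comp_def]
    rw [h3]
    exact (measurable_of_countable _).comp h2
  have h4 : Measurable fun p : Tree Q × Node => p.1 p.2 :=
    measurable_from_prod_countable_left fun x => measurable_pi_apply x
  exact h4.comp (measurable_fst.prodMk (h1.comp measurable_snd))

end Measurability

instance : IsProbabilityMeasure coinMeasure := by
  unfold coinMeasure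
  infer_instance

/-- Independent choices, restricted along an injection and mapped one by one, are independent. -/
lemma map_infinitePi_comp_injective {ι κ X Y : Type*} [MeasurableSpace X] [MeasurableSpace Y]
    (μ : ι → Measure X) [∀ i, IsProbabilityMeasure (μ i)] {f : κ → ι} (hf : f.Injective)
    {g : κ → X → Y} (hg : ∀ k, Measurable (g k)) :
    (Measure.infinitePi μ).map (fun c k => g k (c (f k))) =
      Measure.infinitePi fun k => (μ (f k)).map (g k) := by
  classical
  have : ∀ k, IsProbabilityMeasure ((μ (f k)).map (g k)) := fun k =>
    Measure.isProbabilityMeasure_map (hg k).aemeasurable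
  refine Measure.eq_infinitePi _ fun s u hu => ?_
  -- Injectivity of `f` puts one constraint on each index `f k`; the default `Set.univ` is never
  -- consulted, as the box only ranges over `s.image f`.
  let v : ι → Set X := Function.extend f (fun k => g k ⁻¹' u k) fun _ => Set.univ
  have hvf : ∀ k, v (f k) = g k ⁻¹' u k := fun k => hf.extend_apply _ _ k
  have hpre : (fun (c : ι → X) k => g k (c (f k))) ⁻¹' Set.pi s u =
      Set.pi (s.image f : Finset ι) v := by
    ext c
    simp [Set.mem_pi, hvf]
  have hvm : ∀ i ∈ s.image f, MeasurableSet (v i) := by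
    simp only [Finset.mem_image, forall_exists_index, and_imp, forall_apply_eq_imp_iff₂, hvf]
    exact fun k _ => hg k (hu k)
  have hm : Measurable fun (c : ι → X) k => g k (c (f k)) :=
    measurable_pi_lambda _ fun k => (hg k).comp (measurable_pi_apply _)
  rw [Measure.map_apply hm
    (MeasurableSet.pi s.countable_toSet fun k _ => hu k), hpre, Measure.infinitePi_pi _ hvm,
    Finset.prod_image fun _ _ _ _ h => hf h]
  exact Finset.prod_congr rfl fun k _ => by rw [hvf, Measure.map_apply (hg k) (hu k)]

lemma branchNode_succ (b : Branch) (n : ℕ) : branchNode b (n + 1) = branchNode b n ++ [b n] := by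
  simp [branchNode, List.range_succ]

/-- The component of a pair that is sent in the direction `i`. -/
def childOf {Q : Type*} (i : Bool) (s : Q × Q) : Q := if i then s.2 else s.1

/-- The sequence that starts in `q₀` and continues with the chosen successors. -/
def pathOfChoices {Q : Type*} (q₀ : Q) (d : ℕ × Q → Q) : ℕ → Q :=
  fun n => Nat.rec q₀ (fun n q => d (n, q)) n

lemma measurable_pathOfChoices {Q : Type*} [Finite Q] [MeasurableSpace Q]
    [DiscreteMeasurableSpace Q] (q₀ : Q) : Measurable (pathOfChoices q₀) := by
  refine measurable_pi_iff.2 fun n => ?_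
  induction n with
  | zero => exact measurable_const
  | succ n ih =>
    have h : Measurable fun p : (Q → Q) × Q => p.1 p.2 :=
      measurable_from_prod_countable_left fun q => measurable_pi_apply q
    exact h.comp ((measurable_pi_lambda (fun (d : ℕ × Q → Q) q => d (n, q))
      fun q => measurable_pi_apply (n, q)).prodMk ih)

/-! ### Random runs along a fixed branch -/

namespace TreeAutomaton

variable {Q A : Type*}

lemma labelsAlong_runOfChoices (T : TreeAutomaton Q A) (c : Node × Q → Q × Q) (b : Branch) :
    labelsAlong (T.runOfChoices c) b =
      pathOfChoices T.init fun i => childOf (b i.1) (c (branchNode b i.1, i.2)) := by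
  ext n
  induction n with
  | zero => exact T.runOfChoices_nil c
  | succ n ih =>
    simp only [labelsAlong] at ih
    simp only [labelsAlong, branchNode_succ, runOfChoices_append, ih]
    rfl

variable [Finite Q] [MeasurableSpace Q] [DiscreteMeasurableSpace Q]

/-- The labels along a fixed branch of a random run form a path whose successors are drawn from
the marginals of the transition distributions. -/
lemma map_labelsAlong_runMeasure (T : TreeAutomaton Q A) (t : Tree A) (b : Branch) :
    (T.runMeasure t).map (fun r => labelsAlong r b) =
      (Measure.infinitePi fun i : ℕ × Q =>
        ((T.δ i.2 (t (branchNode b i.1))).map (childOf (b i.1))).toMeasure).map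
          (pathOfChoices T.init) := by
  have hl : Measurable fun r : Tree Q => labelsAlong r b :=
    measurable_pi_lambda _ fun n => measurable_pi_apply _
  -- The length of a node on `b` recovers its level, so distinct levels use distinct, hence
  -- independent, choices.
  have hinj : Function.Injective fun i : ℕ × Q => (branchNode b i.1, i.2) := by
    rintro ⟨n, q⟩ ⟨m, q'⟩ h
    have h1 := congrArg (fun p : Node × Q => p.1.length) h
    simp only [length_branchNode] at h1
    exact Prod.ext h1 (congrArg Prod.snd h :)
  have hc : ∀ i : ℕ × Q, Measurable (childOf (Q := Q) (b i.1)) := fun i => measurable_of_countable _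
  have h := map_infinitePi_comp_injective
    (fun i : Node × Q => (T.δ i.2 (t i.1)).toMeasure) hinj hc
  simp only [PMF.toMeasure_map _ _ (hc _)] at h
  have hm : Measurable fun (c : Node × Q → Q × Q) (i : ℕ × Q) =>
      childOf (b i.1) (c (branchNode b i.1, i.2)) :=
    measurable_pi_lambda _ fun i => (hc i).comp (measurable_pi_apply _)
  rw [← h, runMeasure, Measure.map_map hl T.measurable_runOfChoices,
    Measure.map_map (measurable_pathOfChoices _) hm]
  congr 1
  ext c : 1
  exact T.labelsAlong_runOfChoices c b

lemma measurableSet_isRun (T : TreeAutomaton Q A) (t : Tree A) :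
    MeasurableSet {r | T.IsRun t r} := by
  have h1 : MeasurableSet {r : Tree Q | r [] = T.init} :=
    measurable_pi_apply (X := fun _ : Node => Q) [] (MeasurableSet.singleton T.init)
  have h2 : ∀ x : Node, MeasurableSet
      {r : Tree Q | 0 < T.δ (r x) (t x) (r (x ++ [false]), r (x ++ [true]))} := fun x =>
    ((measurable_pi_apply x).prodMk ((measurable_pi_apply (x ++ [false])).prodMk
      (measurable_pi_apply (x ++ [true]))) : Measurable fun r : Tree Q =>
        (r x, r (x ++ [false]), r (x ++ [true])))
      (Set.toFinite {s : Q × Q × Q | 0 < T.δ s.1 (t x) s.2}).measurableSet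
  have : {r | T.IsRun t r} = {r : Tree Q | r [] = T.init} ∩
      ⋂ x : Node, {r : Tree Q | 0 < T.δ (r x) (t x) (r (x ++ [false]), r (x ++ [true]))} := by
    ext r
    simp [IsRun]
  rw [this]
  exact h1.inter (MeasurableSet.iInter h2)

/-- Almost surely all of the countably many choices, even those at pairs `(x, q)` that the run never
consults, have positive probability. -/
lemma ae_isRun (T : TreeAutomaton Q A) (t : Tree A) : ∀ᵐ r ∂T.runMeasure t, T.IsRun t r := by
  rw [runMeasure, ae_map_iff T.measurable_runOfChoices.aemeasurable (T.measurableSet_isRun t)]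
  have h : ∀ᵐ c ∂Measure.infinitePi fun i : Node × Q => (T.δ i.2 (t i.1)).toMeasure,
      ∀ i : Node × Q, 0 < T.δ i.2 (t i.1) (c i) := by
    refine ae_all_iff.2 fun i => ?_
    have h1 : ∀ᵐ s ∂(T.δ i.2 (t i.1)).toMeasure, 0 < T.δ i.2 (t i.1) s := by
      rw [ae_iff, PMF.toMeasure_apply_eq_zero_iff _ (Set.toFinite _).measurableSet,
        Set.disjoint_left]
      intro s hs
      simpa [pos_iff_ne_zero] using hs
    exact (measurePreserving_eval_infinitePi
      (fun i : Node × Q => (T.δ i.2 (t i.1)).toMeasure) i).quasiMeasurePreserving.ae h1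
  filter_upwards [h] with c hc
  refine ⟨T.runOfChoices_nil c, fun x => ?_⟩
  simpa [runOfChoices_append] using hc (x, T.runOfChoices c x)

/-- A tree is in the qualitative almost-sure language if and only if almost every branch is
accepting in almost every run. -/
lemma mem_qualASLanguage_iff (T : TreeAutomaton Q A) (hacc : MeasurableSet T.acc) (t : Tree A) :
    t ∈ T.qualASLanguage ↔ ∀ᵐ b ∂coinMeasure,
      ∀ᵐ ρ ∂(T.runMeasure t).map (fun r => labelsAlong r b), ρ ∈ T.acc := by
  have hm : MeasurableSet {p : Tree Q × Branch | labelsAlong p.1 p.2 ∈ T.acc} :=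
    measurable_labelsAlong hacc
  have hl : ∀ b, Measurable fun r : Tree Q => labelsAlong r b := fun b =>
    measurable_pi_lambda _ fun n => measurable_pi_apply _
  have hq : MeasurableSet {r : Tree Q | T.IsQualAccepting r} :=
    (measurable_measure_prodMk_left (ν := coinMeasure) hm) (MeasurableSet.singleton 1)
  have h1 : ∀ r : Tree Q, T.IsQualAccepting r ↔ ∀ᵐ b ∂coinMeasure, labelsAlong r b ∈ T.acc :=
    fun r => (mem_ae_iff_prob_eq_one (measurable_prodMk_left hm)).symm
  have h2 : t ∈ T.qualASLanguage ↔ ∀ᵐ r ∂T.runMeasure t, T.IsRun t r ∧ T.IsQualAccepting r :=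
    (mem_ae_iff_prob_eq_one ((T.measurableSet_isRun t).inter hq)).symm
  -- Being a run holds almost surely and drops out; what remains is a double "almost every" over
  -- runs and branches, whose order is exchanged.
  rw [h2, Filter.eventually_and, and_iff_right (T.ae_isRun t),
    Filter.eventually_congr (Filter.Eventually.of_forall h1), Measure.ae_ae_comm hm]
  exact Filter.eventually_congr (Filter.Eventually.of_forall fun b =>
    (ae_map_iff (p := (· ∈ T.acc)) (hl b).aemeasurable hacc).symm)

/-- The qualitative almost-sure language depends only on the initial state, the acceptance
condition and the two marginals of the transition distributions. -/
lemma qualASLanguage_congr {T T' : TreeAutomaton Q A} (hacc : MeasurableSet T.acc)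
    (hinit : T.init = T'.init) (h : T.acc = T'.acc)
    (hδ : ∀ q a i, (T.δ q a).map (childOf i) = (T'.δ q a).map (childOf i)) :
    T.qualASLanguage = T'.qualASLanguage := by
  ext t
  rw [T.mem_qualASLanguage_iff hacc, T'.mem_qualASLanguage_iff (h ▸ hacc)]
  simp only [map_labelsAlong_runMeasure, hδ, hinit, h]

end TreeAutomaton

/-! ### The marginals of the two tree automata -/

namespace WordAutomaton

variable {Q A : Type*} [Fintype Q]

/-- In either direction, `(p, p)` is the only transition of nonzero weight that can send `p`. -/
lemma map_childOf_toTreeAutomaton (W : WordAutomaton Q A) (q : Q) (a : A) (i : Bool) :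
    (W.toTreeAutomaton.δ q a).map (childOf i) = W.δ q a := by
  classical
  have h : ∀ s : Q × Q, W.toTreeAutomaton.δ q a s = if s.1 = s.2 then W.δ q a s.1 else 0 :=
    fun s => by simp [toTreeAutomaton]
  ext p
  rw [PMF.map_apply, tsum_fintype, Fintype.sum_prod_type, Finset.sum_eq_single p]
  · simp only [h]
    rw [Finset.sum_eq_single p] <;> cases i <;> simp +contextual [childOf, eq_comm]
  · intro x _ hx
    refine Finset.sum_eq_zero fun y _ => ?_
    simp only [h]
    cases i <;> simp only [childOf] <;> grind
  · simp

/-- Each of the two successors is the first component of exactly one of `(p, p')`, `(p', p)` and the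
second component of the other, so it gets `1/2` in either direction. -/
lemma map_childOf_switchAutomaton (W : WordAutomaton Q A) (hW : W.BinaryBranching) (q : Q) (a : A)
    (i : Bool) : ((W.switchAutomaton hW).δ q a).map (childOf i) = W.δ q a := by
  classical
  obtain ⟨p, p', hne, h⟩ := hW.exists_succs q a
  have h1 : ∀ s : Q × Q, (W.switchAutomaton hW).δ q a s =
      if s ∈ ({(p, p'), (p', p)} : Finset (Q × Q)) then 1 / 2 else 0 := by
    rintro ⟨x, y⟩
    simp only [switchAutomaton, PMF.ofFintype_apply, h, Set.pair_eq_pair_iff, Finset.mem_insert,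
      Finset.mem_singleton, Prod.mk.injEq]
    congr 1
    grind
  have h2 : (p, p') ≠ (p', p) := fun h => hne (Prod.ext_iff.1 h).1
  have h3 : ∀ x, W.δ q a x = if x = p ∨ x = p' then 1 / 2 else 0 := by
    intro x
    have hx : W.δ q a x = 1 / 2 ↔ x = p ∨ x = p' := by
      simpa [succs] using Set.ext_iff.1 h x
    split_ifs with h4
    · exact hx.2 h4
    · exact (hW q a x).resolve_right (mt hx.1 h4)
  ext x
  rw [PMF.map_apply, tsum_fintype, h3]
  simp only [h1, ← ite_and]
  -- With membership in the pair of transitions as the outer condition, the sum collapses to two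
  -- terms.
  simp only [and_comm (a := x = _), ite_and]
  rw [Finset.sum_ite_mem, Finset.univ_inter, Finset.sum_pair h2]
  by_cases hp : x = p <;> by_cases hp' : x = p' <;> cases i <;> simp_all [childOf]

end WordAutomaton

end ProbAut

theorem mainTheorem5 {Q A : Type*} [Fintype Q] [MeasurableSpace Q] [DiscreteMeasurableSpace Q]
    [Finite A] [Nonempty A] (W : ProbAut.WordAutomaton Q A)
    (hparity : ProbAut.IsParityCondition W.acc) (hbin : W.BinaryBranching) :
    W.toTreeAutomaton.qualASLanguage = (W.switchAutomaton hbin).qualASLanguage :=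
  ProbAut.TreeAutomaton.qualASLanguage_congr hparity.measurableSet rfl rfl fun q a i => by
    rw [W.map_childOf_toTreeAutomaton, W.map_childOf_switchAutomaton hbin]
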